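/- Let $S=k[x_1,\dots,x_n]$ be a polynomial ring over a field $k$, with its standard grading, and let $\mathfrak m=(x_1,\dots,x_n)$. For a homogeneous ideal $I$ of $S$ let $$\mathrm{reg}(I)=\max\{\,t+i \mid i\ge 0,\ t\in\mathbb Z,\ [H^i_{\mathfrak m}(I)]_t\neq 0\,\}$$ be its Castelnuovo–Mumford regularity, where $H^i_{\mathfrak m}(I)$ is the $i$-th graded local cohomology module of the graded $S$-module $I$, and $\mathrm{reg}(0)=-\infty$. Call $I$ a pure power complete intersection if it has a minimal set of generators each of which is a power $x_j^{d}$, $d\ge 1$, of a single variable. If $I$, $J$ and $K$ are three pure power complete intersections in $S$, then $$\mathrm{reg}(IJK)\le \mathrm{reg}(I)+\mathrm{reg}(J)+\mathrm{reg}(K).$$ -/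

import Mathlib

namespace CMRegularity

open MvPolynomial

noncomputable section

/-- The Laurent polynomial ring `k[x₁^±¹, …, xₙ^±¹]`, as the group algebra of `ℤⁿ`. -/
abbrev Laurent (k : Type*) [Field k] (n : ℕ) : Type _ :=
  AddMonoidAlgebra k (Fin n → ℤ)

/-- The inclusion of `S = k[x₁, …, xₙ]` into the Laurent polynomial ring. -/
def toLaurent (k : Type*) [Field k] (n : ℕ) :
    MvPolynomial (Fin n) k →ₐ[k] Laurent k n :=
  MvPolynomial.aeval (fun i => AddMonoidAlgebra.single (Pi.single i (1 : ℤ)) (1 : k))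

/-- The localization `I_{x_A}` of an ideal `I` of `S` at the powers of `x_A = ∏_{i ∈ A} xᵢ`.
Since `S` is a domain, it is the set of those Laurent polynomials `f` such that
`x_A ^ N * f ∈ I` for some `N`. -/
def localized {k : Type*} [Field k] {n : ℕ} (I : Ideal (MvPolynomial (Fin n) k))
    (A : Finset (Fin n)) : Submodule k (Laurent k n) where
  carrier := {f | ∃ N : ℕ, ∃ g ∈ I,
    toLaurent k n g = toLaurent k n (∏ i ∈ A, X i) ^ N * f}
  zero_mem' := ⟨0, 0, I.zero_mem, by simp⟩
  add_mem' := by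
    rintro f f' ⟨N, g, hg, h⟩ ⟨N', g', hg', h'⟩
    refine ⟨N + N', (∏ i ∈ A, X i) ^ N' * g + (∏ i ∈ A, X i) ^ N * g',
      I.add_mem (I.mul_mem_left _ hg) (I.mul_mem_left _ hg'), ?_⟩
    rw [map_add, map_mul, map_mul, map_pow, map_pow, h, h']
    ring
  smul_mem' := by
    rintro a f ⟨N, g, hg, h⟩
    refine ⟨N, a • g, Submodule.smul_of_tower_mem I a hg, ?_⟩
    rw [map_smul, h, mul_smul_comm]

/-- The Laurent polynomials that are homogeneous of total degree `t`. -/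
def homogeneousPart (k : Type*) [Field k] (n : ℕ) (t : ℤ) : Submodule k (Laurent k n) :=
  AddMonoidAlgebra.gradeBy k (fun e : Fin n → ℤ => ∑ i, e i) t

/-- The degree `t` part of the module `Cᵖ = ⨁_{|A| = p} I_{x_A}` of the Čech complex of a
homogeneous ideal `I` on `x₁, …, xₙ`. A cochain is a family of Laurent polynomials indexed by
all subsets `A` of the variables, zero at those `A` that do not have exactly `p` elements. -/
def cochains {k : Type*} [Field k] {n : ℕ} (I : Ideal (MvPolynomial (Fin n) k)) (p t : ℤ) :
    Submodule k (Finset (Fin n) → Laurent k n) where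
  carrier := {c | ∀ A, c A ∈ localized I A ⊓ homogeneousPart k n t ∧ ((A.card : ℤ) ≠ p → c A = 0)}
  zero_mem' := fun _ => ⟨Submodule.zero_mem _, fun _ => rfl⟩
  add_mem' := fun hc hd A => ⟨Submodule.add_mem _ (hc A).1 (hd A).1, fun h => by
    rw [Pi.add_apply, (hc A).2 h, (hd A).2 h, add_zero]⟩
  smul_mem' := fun a _ hc A => ⟨Submodule.smul_mem _ a (hc A).1, fun h => by
    rw [Pi.smul_apply, (hc A).2 h, smul_zero]⟩

/-- The Čech differential `(dc)(A) = ∑_{i ∈ A} (-1)^{#{j ∈ A : j < i}} c(A ∖ {i})`. -/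
def cechD (k : Type*) [Field k] (n : ℕ) :
    (Finset (Fin n) → Laurent k n) →ₗ[k] (Finset (Fin n) → Laurent k n) where
  toFun c A := ∑ i ∈ A, ((-1 : k) ^ (A.filter (· < i)).card) • c (A.erase i)
  map_add' c d := by
    funext A
    simp only [Pi.add_apply, smul_add, Finset.sum_add_distrib]
  map_smul' a c := by
    funext A
    simp only [Pi.smul_apply, RingHom.id_apply, Finset.smul_sum]
    exact Finset.sum_congr rfl fun i _ => smul_comm _ _ _

theorem localized_mono {k : Type*} [Field k] {n : ℕ} (I : Ideal (MvPolynomial (Fin n) k))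
    {A B : Finset (Fin n)} (h : A ⊆ B) : localized I A ≤ localized I B := by
  rintro f ⟨N, g, hg, e⟩
  refine ⟨N, (∏ i ∈ B \ A, X i) ^ N * g, I.mul_mem_left _ hg, ?_⟩
  rw [map_mul, e, ← Finset.prod_sdiff h, map_mul, map_pow]
  ring

theorem cechD_mem_cochains {k : Type*} [Field k] {n : ℕ} (I : Ideal (MvPolynomial (Fin n) k))
    (p t : ℤ) {c : Finset (Fin n) → Laurent k n} (hc : c ∈ cochains I p t) :
    cechD k n c ∈ cochains I (p + 1) t := by
  intro A
  refine ⟨Submodule.sum_mem _ fun i _ => Submodule.smul_mem _ _ ?_, fun hA => ?_⟩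
  · exact ⟨localized_mono I (A.erase_subset i) (hc (A.erase i)).1.1, (hc (A.erase i)).1.2⟩
  · refine Finset.sum_eq_zero fun i hi => ?_
    rw [(hc (A.erase i)).2, smul_zero]
    have := Finset.card_erase_add_one hi
    omega

theorem sign_swap (k : Type*) [Field k] {n : ℕ} (A : Finset (Fin n)) {i j : Fin n}
    (hi : i ∈ A) (hij : i < j) :
    (-1 : k) ^ (A.filter (· < i)).card * (-1) ^ ((A.erase i).filter (· < j)).card +
      (-1) ^ (A.filter (· < j)).card * (-1) ^ ((A.erase j).filter (· < i)).card = 0 := by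
  have h1 : (A.erase j).filter (· < i) = A.filter (· < i) := by
    ext a
    simp only [Finset.mem_filter, Finset.mem_erase]
    constructor
    · exact fun h => ⟨h.1.2, h.2⟩
    · exact fun h => ⟨⟨(h.2.trans hij).ne, h.1⟩, h.2⟩
  have h2 : ((A.erase i).filter (· < j)).card + 1 = (A.filter (· < j)).card := by
    rw [Finset.filter_erase]
    exact Finset.card_erase_add_one (Finset.mem_filter.2 ⟨hi, hij⟩)
  rw [h1, ← h2]
  ring

theorem cechD_cechD {k : Type*} [Field k] {n : ℕ} (c : Finset (Fin n) → Laurent k n) :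
    cechD k n (cechD k n c) = 0 := by
  funext A
  change ∑ i ∈ A, ((-1 : k) ^ (A.filter (· < i)).card) • ∑ j ∈ A.erase i,
    ((-1 : k) ^ ((A.erase i).filter (· < j)).card) • c ((A.erase i).erase j) = 0
  simp only [Finset.smul_sum, smul_smul]
  rw [Finset.sum_sigma']
  refine Finset.sum_involution (fun x _ => ⟨x.2, x.1⟩) ?_ ?_ ?_ ?_
  · rintro ⟨i, j⟩ h
    simp only [Finset.mem_sigma, Finset.mem_erase] at h
    obtain ⟨hi, hji, hj⟩ := h
    dsimp only
    rw [Finset.erase_right_comm, ← add_smul]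
    rcases lt_or_gt_of_ne hji with hlt | hlt
    · rw [add_comm, sign_swap k A hj hlt, zero_smul]
    · rw [sign_swap k A hi hlt, zero_smul]
  · rintro ⟨i, j⟩ h _ e
    simp only [Finset.mem_sigma, Finset.mem_erase] at h
    exact h.2.1 (congrArg Sigma.fst e)
  · rintro ⟨i, j⟩ h
    simp only [Finset.mem_sigma, Finset.mem_erase] at h ⊢
    exact ⟨h.2.2, h.2.1.symm, h.1⟩
  · rintro ⟨i, j⟩ _
    rfl

/-- Homogeneous Čech cocycles of cohomological degree `p` and internal degree `t`. -/
def cocycles {k : Type*} [Field k] {n : ℕ} (I : Ideal (MvPolynomial (Fin n) k)) (p t : ℤ) :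
    Submodule k (Finset (Fin n) → Laurent k n) :=
  cochains I p t ⊓ LinearMap.ker (cechD k n)

/-- Homogeneous Čech coboundaries of cohomological degree `p` and internal degree `t`. -/
def coboundaries {k : Type*} [Field k] {n : ℕ} (I : Ideal (MvPolynomial (Fin n) k)) (p t : ℤ) :
    Submodule k (Finset (Fin n) → Laurent k n) :=
  (cochains I (p - 1) t).map (cechD k n)

theorem coboundaries_le_cocycles {k : Type*} [Field k] {n : ℕ}
    (I : Ideal (MvPolynomial (Fin n) k)) (p t : ℤ) : coboundaries I p t ≤ cocycles I p t := by
  rintro _ ⟨c, hc, rfl⟩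
  exact ⟨by simpa using cechD_mem_cochains I (p - 1) t hc, cechD_cechD c⟩

/-- The degree `t` part `[Hᵖ_𝔪(I)]_t` of the `p`-th local cohomology module, with support in
`𝔪 = (x₁, …, xₙ)`, of a homogeneous ideal `I` of `k[x₁, …, xₙ]` (as a graded module), computed
by the Čech complex on `x₁, …, xₙ`. -/
abbrev LocalCohomologyPart {k : Type*} [Field k] {n : ℕ} (I : Ideal (MvPolynomial (Fin n) k))
    (p t : ℤ) : Type _ :=
  cocycles I p t ⧸ (coboundaries I p t).submoduleOf (cocycles I p t)

/-- The Castelnuovo–Mumford regularity of a homogeneous ideal `I` of `k[x₁, …, xₙ]`,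
`reg I = max {t + p | p ≥ 0, [Hᵖ_𝔪(I)]_t ≠ 0}`, with value `-∞` if all local cohomology
vanishes (that is, if `I = 0`). -/
def reg {k : Type*} [Field k] {n : ℕ} (I : Ideal (MvPolynomial (Fin n) k)) : EReal :=
  sSup {r : EReal | ∃ (p : ℕ) (t : ℤ), Nontrivial (LocalCohomologyPart I p t) ∧
    r = (((t + p : ℤ) : ℝ) : EReal)}

/-- `I` is a pure power complete intersection: it has a minimal set `G` of generators each of
which is a (positive) power of a single variable. -/
def IsPurePowerCI {k : Type*} [Field k] {n : ℕ} (I : Ideal (MvPolynomial (Fin n) k)) : Prop :=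
  ∃ G : Finset (MvPolynomial (Fin n) k),
    (∀ u ∈ G, ∃ (i : Fin n) (d : ℕ), 0 < d ∧ u = X i ^ d) ∧
    Ideal.span (G : Set (MvPolynomial (Fin n) k)) = I ∧
    ∀ u ∈ G, u ∉ Ideal.span ((G : Set (MvPolynomial (Fin n) k)) \ {u})

end

end CMRegularity

/-! In multidegree `a`, the Čech complex of a monomial ideal is the signed cochain complex on the
up-closed family of sets `A` for which `x^a` lies in the localization at `x_A`. A regularity bound
`r` thus amounts to exactness of this complex in every degree `p` with `∑ aᵢ + p > r`.

For a nonzero pure power ideal, an explicit class gives `reg ≥ ∑ (dᵢ - 1) + 1`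
(`le_reg_purePowers`). It remains to bound the regularity of the product by the sum of these three
numbers.

A generator of the product chooses one variable for each factor, so it distributes three labels over
the variables. `exactAt_degreeMem` generalizes this: the distributed labels must form a member of an
upward closed family `F` whose minimal members have at most `c` elements, and exactness holds once
`∑ aᵢ + p` exceeds the sum of all `d - 1` plus `c`. The induction removes the largest variable. Both
its deletion and its link are complexes of the same kind, for residual families of `F`. If these
families agree, the complex is a cone; otherwise `generatedInCard_residualFamily` bounds the new
values of `c`, and this is where having only three labels matters. -/

namespace CMRegularity

/-! ### Signed cochains on set families: deletion, link and cones. -/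

section SignedComplex

section

variable {ι k : Type*} [Field k]

/-- `φ` is a cochain of degree `p` supported on the family `Δ`. -/
def IsCochainOn (Δ : Set (Finset ι)) (p : ℤ) (φ : Finset ι → k) : Prop :=
  ∀ A, φ A ≠ 0 → A ∈ Δ ∧ (A.card : ℤ) = p

theorem IsCochainOn.eq_zero_of_notMem {Δ : Set (Finset ι)} {p : ℤ} {φ : Finset ι → k}
    (h : IsCochainOn Δ p φ) {A : Finset ι} (hA : A ∉ Δ) : φ A = 0 :=
  by_contra fun h' => hA (h A h').1

theorem IsCochainOn.eq_zero_of_card_ne {Δ : Set (Finset ι)} {p : ℤ} {φ : Finset ι → k}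
    (h : IsCochainOn Δ p φ) {A : Finset ι} (hA : (A.card : ℤ) ≠ p) : φ A = 0 :=
  by_contra fun h' => hA (h A h').2

end

variable {ι k : Type*} [LinearOrder ι] [Field k]

/-- The simplicial coboundary on scalar-valued functions of finite sets. -/
def simplicialD (φ : Finset ι → k) (A : Finset ι) : k :=
  ∑ i ∈ A, (-1 : k) ^ (A.filter (· < i)).card * φ (A.erase i)

/-- Exactness in degree `p` of the complex of cochains supported on the family `Δ`. -/
def ExactAt (k : Type*) [Field k] (Δ : Set (Finset ι)) (p : ℤ) : Prop :=
  ∀ φ : Finset ι → k, IsCochainOn Δ p φ → (∀ A ∈ Δ, simplicialD φ A = 0) →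
    ∃ ψ : Finset ι → k, IsCochainOn Δ (p - 1) ψ ∧ ∀ A ∈ Δ, simplicialD ψ A = φ A

theorem simplicialD_congr {φ ψ : Finset ι → k} {A : Finset ι}
    (h : ∀ i ∈ A, φ (A.erase i) = ψ (A.erase i)) : simplicialD φ A = simplicialD ψ A :=
  Finset.sum_congr rfl fun i hi => by rw [h i hi]

theorem simplicialD_add (φ ψ : Finset ι → k) (A : Finset ι) :
    simplicialD (fun B => φ B + ψ B) A = simplicialD φ A + simplicialD ψ A := by
  simp only [simplicialD, mul_add, Finset.sum_add_distrib]

theorem simplicialD_smul (c : k) (φ : Finset ι → k) (A : Finset ι) :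
    simplicialD (fun B => c * φ B) A = c * simplicialD φ A := by
  simp only [simplicialD, Finset.mul_sum]
  exact Finset.sum_congr rfl fun i _ => by ring

theorem simplicialD_insert (φ : Finset ι → k) {A : Finset ι} {i : ι} (hi : ∀ j ∈ A, j < i) :
    simplicialD φ (insert i A) =
      simplicialD (fun B => φ (insert i B)) A + (-1) ^ A.card * φ A := by
  have hA : i ∉ A := fun h => lt_irrefl i (hi i h)
  rw [simplicialD, Finset.sum_insert hA, add_comm]
  congr 1
  · refine Finset.sum_congr rfl fun j hj => ?_
    rw [Finset.filter_insert, if_neg (hi j hj).not_gt,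
      Finset.erase_insert_of_ne (hi j hj).ne']
  · rw [Finset.erase_insert hA, Finset.filter_insert, if_neg (lt_irrefl i),
      Finset.filter_true_of_mem hi]

theorem exactAt_empty (p : ℤ) : ExactAt k (∅ : Set (Finset ι)) p := by
  intro φ hφ _
  exact ⟨0, fun A h => absurd rfl h, fun A h => h.elim⟩

variable {V : Finset ι} {i : ι} {Δ : Set (Finset ι)} {p : ℤ}

/-- Primitives on the deletion and on the link of a largest vertex glue to a primitive. -/
theorem exists_primitive_of_deletion_link (hi : ∀ j ∈ V, j < i)
    (hV : ∀ A ∈ Δ, A ⊆ insert i V) {φ ψ₀ ψ₁ : Finset ι → k}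
    (h₀ : IsCochainOn {A | A ⊆ V ∧ A ∈ Δ} (p - 1) ψ₀)
    (h₁ : IsCochainOn {A | A ⊆ V ∧ insert i A ∈ Δ} (p - 1 - 1) ψ₁)
    (e₀ : ∀ A ⊆ V, A ∈ Δ → simplicialD ψ₀ A = φ A)
    (e₁ : ∀ A ⊆ V, insert i A ∈ Δ →
      simplicialD ψ₁ A + (-1) ^ A.card * ψ₀ A = φ (insert i A)) :
    ∃ ψ : Finset ι → k, IsCochainOn Δ (p - 1) ψ ∧ ∀ A ∈ Δ, simplicialD ψ A = φ A := by
  have hiV : i ∉ V := fun h => lt_irrefl i (hi i h)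
  refine ⟨fun A => if i ∈ A then ψ₁ (A.erase i) else ψ₀ A, fun A hA => ?_, fun A hA => ?_⟩
  · by_cases h : i ∈ A
    · simp only [h, if_true] at hA
      obtain ⟨⟨-, h2⟩, h3⟩ := h₁ _ hA
      rw [Finset.insert_erase h] at h2
      have := Finset.card_erase_add_one h
      exact ⟨h2, by omega⟩
    · simp only [h, if_false] at hA
      exact ⟨(h₀ _ hA).1.2, (h₀ _ hA).2⟩
  · by_cases h : i ∈ A
    · have hB : A.erase i ⊆ V := by
        intro x hx
        have := hV A hA (Finset.mem_of_mem_erase hx)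
        exact (Finset.mem_insert.1 this).resolve_left (Finset.ne_of_mem_erase hx)
      have hins := Finset.insert_erase h
      have hAi : insert i (A.erase i) ∈ Δ := by rwa [hins]
      rw [← hins, simplicialD_insert _ fun j hj => hi j (hB hj), ← e₁ _ hB hAi]
      congr 1
      · refine simplicialD_congr fun j hj => ?_
        simp
      · simp
    · have hAV : A ⊆ V := (Finset.subset_insert_iff_of_notMem h).1 (hV A hA)
      rw [← e₀ A hAV hA]
      refine simplicialD_congr fun j hj => if_neg fun h' => h (Finset.mem_of_mem_erase h')

/-- This is the long exact sequence of deletion and link in explicit form: integrate on the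
deletion, correct the link part by that primitive, then integrate on the link. -/
theorem ExactAt.of_deletion_link (hi : ∀ j ∈ V, j < i) (hV : ∀ A ∈ Δ, A ⊆ insert i V)
    (hup : ∀ A ∈ Δ, ∀ B ⊆ insert i V, A ⊆ B → B ∈ Δ)
    (h₀ : ExactAt k {A | A ⊆ V ∧ A ∈ Δ} p)
    (h₁ : ExactAt k {A | A ⊆ V ∧ insert i A ∈ Δ} (p - 1)) : ExactAt k Δ p := by
  intro φ hφ hd
  have hiV : i ∉ V := fun h => lt_irrefl i (hi i h)
  obtain ⟨ψ₀, hψ₀, e₀⟩ := h₀ (fun A => if A ⊆ V then φ A else 0)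
    (fun A hA => by
      by_cases h : A ⊆ V
      · simp only [h, if_true] at hA
        exact ⟨⟨h, (hφ A hA).1⟩, (hφ A hA).2⟩
      · simp [h] at hA)
    (fun A hA => by
      rw [← hd A hA.2]
      exact simplicialD_congr fun j _ => if_pos ((A.erase_subset j).trans hA.1))
  -- The link can contain sets outside `Δ`. There both sides vanish, since by up-closedness all
  -- facets of such a set are outside `Δ` too.
  have e₀' : ∀ A ⊆ V, simplicialD ψ₀ A = φ A := by
    intro A hAV
    by_cases hA : A ∈ Δ
    · rw [e₀ A ⟨hAV, hA⟩, if_pos hAV]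
    · rw [hφ.eq_zero_of_notMem hA, simplicialD]
      refine Finset.sum_eq_zero fun j _ => ?_
      rw [hψ₀.eq_zero_of_notMem, mul_zero]
      rintro ⟨-, h⟩
      exact hA (hup _ h A (hAV.trans (Finset.subset_insert i V)) (A.erase_subset j))
  obtain ⟨ψ₁, hψ₁, e₁⟩ := h₁
    -- The correction is `-(-1)^|A| ψ₀ A`. As `ψ₀` lives on sets of size `p - 1`, the sign is the
    -- constant `(-1)^p`, which commutes with the differential.
    (fun A => (if A ⊆ V then φ (insert i A) else 0) + (-1) ^ p.natAbs * ψ₀ A)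
    (fun A hA => by
      by_cases h : A ⊆ V
      · by_cases h2 : φ (insert i A) = 0
        · have h3 : ψ₀ A ≠ 0 := fun h3 => by simp [h2, h3] at hA
          obtain ⟨⟨-, h4⟩, h5⟩ := hψ₀ A h3
          exact ⟨⟨h, hup A h4 _ (Finset.insert_subset_insert i h) (Finset.subset_insert i A)⟩, h5⟩
        · obtain ⟨h4, h5⟩ := hφ _ h2
          rw [Finset.card_insert_of_notMem fun h' => hiV (h h')] at h5
          exact ⟨⟨h, h4⟩, by push_cast at h5; omega⟩
      · have : ψ₀ A = 0 := hψ₀.eq_zero_of_notMem fun h' => h h'.1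
        simp [h, this] at hA)
    (fun A hA => by
      obtain ⟨hAV, hA⟩ := hA
      have hj : ∀ j ∈ A, j < i := fun j hj => hi j (hAV hj)
      have h := hd _ hA
      rw [simplicialD_insert _ hj] at h
      rw [simplicialD_add, simplicialD_smul, e₀' A hAV, ← h]
      congr 1
      · exact simplicialD_congr fun j _ => if_pos ((A.erase_subset j).trans hAV)
      · by_cases hc : (A.card : ℤ) = p
        · rw [← hc, Int.natAbs_natCast]
        · rw [hφ.eq_zero_of_card_ne hc, mul_zero, mul_zero])
  refine exists_primitive_of_deletion_link hi hV hψ₀ hψ₁ (fun A hAV _ => e₀' A hAV)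
    fun A hAV hA => ?_
  rw [e₁ A ⟨hAV, hA⟩, if_pos hAV, add_assoc, ← add_mul]
  by_cases hc : (A.card : ℤ) = p - 1
  · have : p.natAbs = A.card + 1 := by omega
    rw [this, pow_succ]
    ring
  · rw [hψ₀.eq_zero_of_card_ne hc, mul_zero, add_zero]

theorem ExactAt.of_deletion_eq_link (hi : ∀ j ∈ V, j < i) (hV : ∀ A ∈ Δ, A ⊆ insert i V)
    (h : ∀ A ⊆ V, insert i A ∈ Δ → A ∈ Δ)
    (h' : ∀ A ⊆ V, A ∈ Δ → insert i A ∈ Δ) : ExactAt k Δ p := by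
  intro φ hφ hd
  have hiV : i ∉ V := fun h => lt_irrefl i (hi i h)
  refine exists_primitive_of_deletion_link hi hV
    -- The cone contraction with apex `i`.
    (ψ₀ := fun A => if A ⊆ V then (-1) ^ A.card * φ (insert i A) else 0) (ψ₁ := fun _ => 0)
    (fun A hA => ?_) (fun A hA => absurd rfl hA) (fun A hAV hA => ?_) (fun A hAV hA => ?_)
  · by_cases hAV : A ⊆ V
    · simp only [hAV, if_true] at hA
      obtain ⟨h4, h5⟩ := hφ _ (right_ne_zero_of_mul hA)
      rw [Finset.card_insert_of_notMem fun h' => hiV (hAV h')] at h5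
      exact ⟨⟨hAV, h A hAV h4⟩, by push_cast at h5; omega⟩
    · simp [hAV] at hA
  · have hj : ∀ j ∈ A, j < i := fun j hj => hi j (hAV hj)
    have h1 := hd _ (h' A hAV hA)
    rw [simplicialD_insert _ hj] at h1
    have h2 : simplicialD (fun A => if A ⊆ V then (-1) ^ A.card * φ (insert i A) else 0) A =
        -(-1) ^ A.card * simplicialD (fun B => φ (insert i B)) A := by
      rw [← simplicialD_smul]
      refine simplicialD_congr fun j hjA => ?_
      rw [if_pos ((A.erase_subset j).trans hAV), ← Finset.card_erase_add_one hjA, pow_succ]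
      ring
    rw [h2, eq_neg_of_add_eq_zero_left h1, neg_mul_neg, ← mul_assoc, ← mul_pow]
    simp
  · rw [if_pos hAV, ← mul_assoc, ← mul_pow]
    simp [simplicialD]

end SignedComplex

/-! ### Families of subsets of a three-element set. -/

section Families

/-- Every member of the family `F` contains a member of cardinality at most `c`. -/
def GeneratedInCard {σ : Type*} (F : Set (Finset σ)) (c : ℕ) : Prop :=
  ∀ T ∈ F, ∃ T' ⊆ T, T' ∈ F ∧ T'.card ≤ c

/-- The sets that become members of `F` after adding a subset `W` of `S` with `G W`. -/
def residualFamily {σ : Type*} [DecidableEq σ] (F : Set (Finset σ)) (S : Finset σ)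
    (G : Finset σ → Prop) : Set (Finset σ) :=
  {U | ∃ W ⊆ S, G W ∧ U ∪ W ∈ F}

theorem isUpperSet_residualFamily {σ : Type*} [DecidableEq σ] {F : Set (Finset σ)}
    (hF : IsUpperSet F) (S : Finset σ) (G : Finset σ → Prop) :
    IsUpperSet (residualFamily F S G) := by
  rintro U U' h ⟨W, hW, hG, hU⟩
  exact ⟨W, hW, hG, hF (Finset.union_subset_union_left h) hU⟩

theorem GeneratedInCard.residualFamily_true {σ : Type*} [DecidableEq σ] {F : Set (Finset σ)}
    {c : ℕ} (h : GeneratedInCard F c) (S : Finset σ) :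
    GeneratedInCard (residualFamily F S fun _ => True) c := by
  rintro U ⟨W, hW, -, hU⟩
  obtain ⟨T, hT, hTF, hc⟩ := h _ hU
  refine ⟨T ∩ U, Finset.inter_subset_right, ⟨T ∩ W, ?_, trivial, ?_⟩, ?_⟩
  · exact Finset.inter_subset_right.trans hW
  · rwa [← Finset.inter_union_distrib_left, Finset.inter_eq_left.2 hT]
  · exact (Finset.card_le_card Finset.inter_subset_left).trans hc

/-- The second inequality makes `S` nonempty, so its complement has at most two elements. The first
makes `T' \ S` larger than `T \ S`; hence either `T \ S` is empty or `T' \ S` is the whole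
complement. This breaks down for four elements. -/
theorem sdiff_subset_sdiff_of_card_lt : ∀ T T' S : Finset (Fin 3),
    T.card < (T' \ S).card + (T ∩ S).card → T'.card < (T' \ S).card + (T ∩ S).card →
      T \ S ⊆ T' \ S := by
  decide

/-- Either `P = T`, and the inequality leaves at most `m - 1` elements of `T` outside `Q`, or `m =
2`, `T` has three elements and `Q` is everything. -/
theorem exists_sdiff_subset_of_card_lt : ∀ T P Q : Finset (Fin 3), P ⊆ T →
    ∀ m : Fin 4, m.val ≤ P.card → T.card + 1 < Q.card + m.val → 2 ≤ m.val →
      ∃ V : Finset (Fin 3), V ⊆ P ∧ V.card + 1 = m.val ∧ T \ V ⊆ Q := by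
  decide

/-- Bounds for the generating cardinalities of the two residual families of a family of subsets
of a set with three elements, when bounding the weight of the removed part by `j` matters. -/
theorem generatedInCard_residualFamily {F : Set (Finset (Fin 3))} (hF : IsUpperSet F) {c : ℕ}
    (hc : GeneratedInCard F c) (S : Finset (Fin 3)) (d : Fin 3 → ℕ)
    (hd : ∀ s ∈ S, 0 < d s) (j : ℤ) (hj : 0 ≤ j)
    (hne : ¬ residualFamily F S (fun _ => True) ⊆
      residualFamily F S fun W => ((∑ s ∈ W, d s : ℕ) : ℤ) ≤ j) :
    ∃ c₁ c₂ : ℕ, GeneratedInCard (residualFamily F S fun _ => True) c₁ ∧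
      GeneratedInCard (residualFamily F S fun W => ((∑ s ∈ W, d s : ℕ) : ℤ) ≤ j) c₂ ∧
      c₁ + j + 1 ≤ c + ∑ s ∈ S, ((d s : ℤ) - 1) ∧ c₂ + j ≤ c + ∑ s ∈ S, ((d s : ℤ) - 1) := by
  have hmono : ∀ {W W' : Finset (Fin 3)}, W ⊆ W' → ∑ s ∈ W, d s ≤ ∑ s ∈ W', d s :=
    fun h => Finset.sum_le_sum_of_subset h
  obtain ⟨U, ⟨W, hW, -, hUW⟩, hU⟩ := Set.not_subset.1 hne
  obtain ⟨T, hT, hTF, hTc⟩ := hc _ hUW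
  have hTS : ¬ ((∑ s ∈ T ∩ S, d s : ℕ) : ℤ) ≤ j := by
    intro h
    refine hU ⟨T ∩ W, Finset.inter_subset_right.trans hW, ?_, hF ?_ hTF⟩
    · exact (Int.ofNat_le.2 (hmono (Finset.inter_subset_inter_left hW))).trans h
    · intro x hx
      have := hT hx
      simp only [Finset.mem_union, Finset.mem_inter] at this ⊢
      tauto
  -- `W₀` will be a smallest subset of `S` of weight above `j`; every smaller subset of `S` respects
  -- the bound.
  let bad : Finset (Finset (Fin 3)) :=
    S.powerset.filter fun W => ¬ ((∑ s ∈ W, d s : ℕ) : ℤ) ≤ j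
  have hbad : T ∩ S ∈ bad := Finset.mem_filter.2
    ⟨Finset.mem_powerset.2 Finset.inter_subset_right, hTS⟩
  obtain ⟨W₀, hW₀, hmin⟩ := Finset.exists_min_image bad Finset.card ⟨_, hbad⟩
  obtain ⟨hW₀S, hW₀j⟩ := Finset.mem_filter.1 hW₀
  rw [Finset.mem_powerset] at hW₀S
  have hgood : ∀ V ⊆ S, V.card < W₀.card → ((∑ s ∈ V, d s : ℕ) : ℤ) ≤ j := by
    intro V hV hlt
    by_contra h
    exact (hmin V (Finset.mem_filter.2 ⟨Finset.mem_powerset.2 hV, h⟩)).not_gt hlt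
  have hmT : W₀.card ≤ (T ∩ S).card := hmin _ hbad
  have hmc : W₀.card ≤ c := hmT.trans ((Finset.card_le_card Finset.inter_subset_left).trans hTc)
  have hm0 : 0 < W₀.card := by
    rw [Finset.card_pos, Finset.nonempty_iff_ne_empty]
    rintro rfl
    simp [hj] at hW₀j
  -- The weight of `W₀` exceeds `j` and equals `|W₀| + ∑ (d - 1)` over `W₀`; the other terms of the
  -- sum over `S` are nonnegative.
  have hsum : j + 1 ≤ W₀.card + ∑ s ∈ S, ((d s : ℤ) - 1) := by
    have h1 : ∑ s ∈ W₀, ((d s : ℤ) - 1) ≤ ∑ s ∈ S, ((d s : ℤ) - 1) :=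
      Finset.sum_le_sum_of_subset_of_nonneg hW₀S fun s hs _ => by have := hd s hs; omega
    rw [Finset.sum_sub_distrib, Finset.sum_const] at h1
    push_cast at hW₀j
    simp only [nsmul_eq_mul, mul_one] at h1
    omega
  have hcard : ∀ A B : Finset (Fin 3), (A ∩ B).card + (A \ B).card = A.card := fun A B =>
    Finset.card_inter_add_card_sdiff A B
  -- Without a bound all of `T ∩ S`, hence at least `|W₀|` labels of `T`, can be removed; with the
  -- bound, any `|W₀| - 1` of them can.
  refine ⟨c - W₀.card, c - W₀.card + 1, ?_, ?_, by omega, by omega⟩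
  · rintro X ⟨W, hW, -, hX⟩
    obtain ⟨T', hT', hTF', hTc'⟩ := hc _ hX
    have hsub : T' \ S ⊆ X := by
      intro x hx
      rw [Finset.mem_sdiff] at hx
      exact (Finset.mem_union.1 (hT' hx.1)).resolve_right fun h => hx.2 (hW h)
    by_cases h : (T' \ S).card ≤ c - W₀.card
    · exact ⟨T' \ S, hsub, ⟨S, subset_rfl, trivial, hF (by simp) hTF'⟩, h⟩
    · refine ⟨T \ S, (sdiff_subset_sdiff_of_card_lt T T' S ?_ ?_).trans hsub,
        ⟨S, subset_rfl, trivial, hF (by simp) hTF⟩, ?_⟩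
      · omega
      · omega
      · have := hcard T S
        omega
  · rintro X ⟨W, hW, hWj, hX⟩
    obtain ⟨T', hT', hTF', hTc'⟩ := hc _ hX
    have hsub : T' \ W ⊆ X := by
      intro x hx
      rw [Finset.mem_sdiff] at hx
      exact (Finset.mem_union.1 (hT' hx.1)).resolve_right hx.2
    by_cases h : (T' \ W).card ≤ c - W₀.card + 1
    · exact ⟨T' \ W, hsub, ⟨W, hW, hWj, hF (by simp) hTF'⟩, h⟩
    · have h3 : W₀.card < 4 := by
        have := Finset.card_le_univ W₀
        rw [Fintype.card_fin] at this
        omega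
      have h4 : (T' \ W).card ≤ c := (Finset.card_le_card Finset.sdiff_subset).trans hTc'
      obtain ⟨V, hV, hVc, hVs⟩ := exists_sdiff_subset_of_card_lt T (T ∩ S) (T' \ W)
        Finset.inter_subset_left ⟨W₀.card, h3⟩ hmT (by simp only; omega) (by simp only; omega)
      simp only at hVc
      refine ⟨T \ V, hVs.trans hsub, ⟨V, hV.trans Finset.inter_subset_right,
        hgood V (hV.trans Finset.inter_subset_right) (by omega), hF (by simp) hTF⟩, ?_⟩
      rw [Finset.card_sdiff_of_subset (hV.trans Finset.inter_subset_left)]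
      omega

end Families

/-! ### Exactness by induction on the variables. -/

section ExponentComplex

variable {ι : Type*}

/-- The members of the family `F`, distributed over the vertices `V` as powers of the variables
with exponents `d`, that divide the monomial with exponent `a` once the variables in `A` are
inverted. -/
def DegreeMem (P : Fin 3 → Finset ι) (d : Fin 3 → ι → ℕ) (V : Finset ι)
    (F : Set (Finset (Fin 3))) (a : ι → ℤ) (A : Finset ι) : Prop :=
  ∃ W : ι → Finset (Fin 3), (∀ i ∈ V, ∀ s ∈ W i, i ∈ P s) ∧ V.biUnion W ∈ F ∧
    ∀ i ∈ V, i ∉ A → ((∑ s ∈ W i, d s i : ℕ) : ℤ) ≤ a i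

variable {P : Fin 3 → Finset ι} {d : Fin 3 → ι → ℕ} {V : Finset ι} {F : Set (Finset (Fin 3))}
  {a : ι → ℤ} {A B : Finset ι} {i : ι}

theorem DegreeMem.mono (h : DegreeMem P d V F a A) (hAB : A ⊆ B) : DegreeMem P d V F a B := by
  obtain ⟨W, h1, h2, h3⟩ := h
  exact ⟨W, h1, h2, fun i hi hiB => h3 i hi fun hiA => hiB (hAB hiA)⟩

variable [LinearOrder ι]

/-- Splitting off the labels placed at `i` covers both the deletion (`B = A`, `G` the weight bound)
and the link (`B = insert i A`, `G` always true). -/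
theorem DegreeMem.insert_vertex_iff (hi : i ∉ V) (G : Finset (Fin 3) → Prop)
    (hG : ∀ W, G W ↔ (i ∉ B → ((∑ s ∈ W, d s i : ℕ) : ℤ) ≤ a i))
    (hB : ∀ j ∈ V, j ∈ B ↔ j ∈ A) :
    DegreeMem P d (insert i V) F a B ↔
      DegreeMem P d V (residualFamily F (Finset.univ.filter (i ∈ P ·)) G) a A := by
  constructor
  · rintro ⟨W, h1, h2, h3⟩
    refine ⟨W, fun j hj => h1 j (Finset.mem_insert_of_mem hj), ⟨W i, fun s hs => ?_, ?_, ?_⟩,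
      fun j hj hjA => h3 j (Finset.mem_insert_of_mem hj) fun h => hjA ((hB j hj).1 h)⟩
    · simpa using h1 i (Finset.mem_insert_self i V) s hs
    · exact (hG _).2 (h3 i (Finset.mem_insert_self i V))
    · rwa [Finset.biUnion_insert, Finset.union_comm] at h2
  · rintro ⟨W, h1, ⟨W', h4, h5, h6⟩, h3⟩
    have hne : ∀ j ∈ V, j ≠ i := fun j hj h => hi (h ▸ hj)
    refine ⟨Function.update W i W', fun j hj => ?_, ?_, fun j hj hjB => ?_⟩
    · rcases Finset.mem_insert.1 hj with rfl | hj
      · rw [Function.update_self]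
        exact fun s hs => (Finset.mem_filter.1 (h4 hs)).2
      · rw [Function.update_of_ne (hne j hj)]
        exact h1 j hj
    · rw [Finset.biUnion_insert, Function.update_self, Finset.union_comm]
      rwa [Finset.biUnion_congr rfl fun j hj => Function.update_of_ne (hne j hj) W' W]
    · rcases Finset.mem_insert.1 hj with rfl | hj
      · rw [Function.update_self]
        exact (hG _).1 h5 hjB
      · rw [Function.update_of_ne (hne j hj)]
        exact h3 j hj fun h => hjB ((hB j hj).2 h)

theorem exactAt_degreeMem (k : Type*) [Field k] (hd : ∀ s, ∀ i ∈ P s, 0 < d s i) (a : ι → ℤ) :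
    ∀ (V : Finset ι) (F : Set (Finset (Fin 3))) (c : ℕ) (p : ℤ), IsUpperSet F →
      GeneratedInCard F c →
      ∑ i ∈ V, ∑ s with i ∈ P s, ((d s i : ℤ) - 1) + c < ∑ i ∈ V, a i + p →
      ExactAt k {A | A ⊆ V ∧ DegreeMem P d V F a A} p := by
  intro V
  induction V using Finset.induction_on_max with
  | empty =>
    intro F c p _ _ hp φ hφ _
    simp only [Finset.sum_empty] at hp
    refine ⟨fun _ => 0, fun A h => absurd rfl h, fun A hA => ?_⟩
    obtain rfl := Finset.subset_empty.1 hA.1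
    rw [hφ.eq_zero_of_card_ne (by simp only [Finset.card_empty]; omega)]
    simp [simplicialD]
  | insert i V hi ih =>
    intro F c p hF hc hp
    have hiV : i ∉ V := fun h => lt_irrefl i (hi i h)
    rw [Finset.sum_insert hiV, Finset.sum_insert hiV] at hp
    set S : Finset (Fin 3) := Finset.univ.filter (i ∈ P ·)
    have hdS : ∀ s ∈ S, 0 < d s i := fun s hs => hd s i (Finset.mem_filter.1 hs).2
    have hsub : ∀ A ∈ {A | A ⊆ insert i V ∧ DegreeMem P d (insert i V) F a A},
      A ⊆ insert i V := fun A hA => hA.1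
    set G : Finset (Fin 3) → Prop := fun W => ((∑ s ∈ W, d s i : ℕ) : ℤ) ≤ a i
    have hdel : ∀ A ⊆ V, (A ∈ {A | A ⊆ insert i V ∧ DegreeMem P d (insert i V) F a A} ↔
        DegreeMem P d V (residualFamily F S G) a A) := by
      intro A hA
      rw [← DegreeMem.insert_vertex_iff (B := A) hiV G
        (fun W => by simp [G, show i ∉ A from fun h => hiV (hA h)]) fun _ _ => Iff.rfl]
      exact and_iff_right (hA.trans (Finset.subset_insert i V))
    have hlink : ∀ A ⊆ V, (insert i A ∈ {A | A ⊆ insert i V ∧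
        DegreeMem P d (insert i V) F a A} ↔
        DegreeMem P d V (residualFamily F S fun _ => True) a A) := by
      intro A hA
      rw [← DegreeMem.insert_vertex_iff (B := insert i A) hiV (fun _ => True)
        (fun W => by simp) fun j hj => by
          simp [show j ≠ i from fun h => hiV (h ▸ hj)]]
      exact and_iff_right (Finset.insert_subset_insert i hA)
    have hup : ∀ A ∈ {A | A ⊆ insert i V ∧ DegreeMem P d (insert i V) F a A},
        ∀ B ⊆ insert i V, A ⊆ B →
          B ∈ {A | A ⊆ insert i V ∧ DegreeMem P d (insert i V) F a A} :=
      fun A hA B hB hAB => ⟨hB, hA.2.mono hAB⟩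
    -- If the weight bound at `i` does not shrink the residual family, adding or removing `i` never
    -- affects membership, and the complex is a cone.
    by_cases heq : residualFamily F S (fun _ => True) ⊆ residualFamily F S G
    · refine ExactAt.of_deletion_eq_link hi hsub (fun A hA h => ?_) fun A hA h =>
        hup A h _ (Finset.insert_subset_insert i hA) (Finset.subset_insert i A)
      rw [hlink A hA] at h
      obtain ⟨W, h1, h2, h3⟩ := h
      exact (hdel A hA).2 ⟨W, h1, heq h2, h3⟩
    · have hdel' : {A | A ⊆ V ∧ A ∈ {A | A ⊆ insert i V ∧ DegreeMem P d (insert i V) F a A}} =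
          {A | A ⊆ V ∧ DegreeMem P d V (residualFamily F S G) a A} :=
        Set.ext fun A => and_congr_right fun hA => hdel A hA
      have hlink' : {A | A ⊆ V ∧ insert i A ∈ {A | A ⊆ insert i V ∧
            DegreeMem P d (insert i V) F a A}} =
          {A | A ⊆ V ∧ DegreeMem P d V (residualFamily F S fun _ => True) a A} :=
        Set.ext fun A => and_congr_right fun hA => hlink A hA
      refine ExactAt.of_deletion_link hi hsub hup ?_ ?_
      · rw [hdel']
        by_cases hai : 0 ≤ a i
        · obtain ⟨-, c₂, -, h2, -, h4⟩ :=
            generatedInCard_residualFamily hF hc S (fun s => d s i) hdS (a i) hai heq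
          exact ih _ c₂ p (isUpperSet_residualFamily hF S G) h2 (by omega)
        -- For `a i < 0` no weight is small enough, so the deletion is empty.
        · convert exactAt_empty p
          refine Set.eq_empty_of_forall_notMem ?_
          rintro A ⟨-, W, -, ⟨W', -, h, -⟩, -⟩
          exact hai ((Int.natCast_nonneg _).trans h)
      · rw [hlink']
        by_cases hai : 0 ≤ a i
        · obtain ⟨c₁, -, h1, -, h3, -⟩ :=
            generatedInCard_residualFamily hF hc S (fun s => d s i) hdS (a i) hai heq
          exact ih _ c₁ (p - 1) (isUpperSet_residualFamily hF S _) h1 (by omega)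
        -- Dropping `a i ≤ -1` compensates for passing from `p` to `p - 1`, so `c` can stay the
        -- same.
        · have : 0 ≤ ∑ s ∈ S, ((d s i : ℤ) - 1) :=
            Finset.sum_nonneg fun s hs => by have := hdS s hs; omega
          exact ih _ c (p - 1) (isUpperSet_residualFamily hF S _) (hc.residualFamily_true S)
            (by omega)

end ExponentComplex

open MvPolynomial

/-! ### Multigraded Čech complexes of monomial ideals. -/

section MonomialIdeal

variable {k : Type*} [Field k] {n : ℕ}

/-- The monomial ideal generated by the monomials with exponents in `E`. -/
noncomputable def monomialIdeal (k : Type*) [Field k] {n : ℕ} (E : Set (Fin n →₀ ℕ)) :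
    Ideal (MvPolynomial (Fin n) k) :=
  Ideal.span ((fun e => monomial e (1 : k)) '' E)

/-- The exponents of the pure powers `xᵢ ^ dᵢ`, `i ∈ P`. -/
def purePowers {n : ℕ} (P : Finset (Fin n)) (d : Fin n → ℕ) : Set (Fin n →₀ ℕ) :=
  {e | ∃ i ∈ P, e = Finsupp.single i (d i)}

/-- The sets `A` of variables for which the monomial with exponent `a` lies in the localization
at the variables in `A` of the monomial ideal generated by `E`. -/
def degreeComplex {n : ℕ} (E : Set (Fin n →₀ ℕ)) (a : Fin n → ℤ) : Set (Finset (Fin n)) :=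
  {A | ∃ e ∈ E, ∀ i ∉ A, (e i : ℤ) ≤ a i}

theorem toLaurent_monomial (e : Fin n →₀ ℕ) (c : k) :
    toLaurent k n (monomial e c) = AddMonoidAlgebra.single (fun i => (e i : ℤ)) c := by
  have h : toLaurent k n (monomial e 1) = AddMonoidAlgebra.single (fun i => (e i : ℤ)) 1 := by
    induction e using Finsupp.induction_linear with
    | zero => exact map_one _
    | add f g hf hg =>
      rw [show monomial (f + g) (1 : k) = monomial f 1 * monomial g 1 by simp [monomial_mul],
        map_mul, hf, hg, AddMonoidAlgebra.single_mul_single, mul_one]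
      congr 1
    | single i m =>
      rw [← X_pow_eq_monomial, map_pow, toLaurent, aeval_X, AddMonoidAlgebra.single_pow, one_pow]
      congr 1
      funext j
      rcases eq_or_ne j i with rfl | hj
      · simp
      · simp [hj]
  rw [show monomial e c = c • monomial e (1 : k) by rw [smul_monomial, smul_eq_mul, mul_one],
    map_smul, h, AddMonoidAlgebra.smul_single, smul_eq_mul, mul_one]

theorem exists_of_coeff_toLaurent_ne_zero {g : MvPolynomial (Fin n) k} {a : Fin n → ℤ}
    (h : (toLaurent k n g).coeff a ≠ 0) :
    ∃ e ∈ g.support, ∀ i, (e i : ℤ) = a i := by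
  rw [← support_sum_monomial_coeff g, map_sum, AddMonoidAlgebra.coeff_sum,
    Finsupp.finsetSum_apply] at h
  obtain ⟨e, he, hne⟩ := Finset.exists_ne_zero_of_sum_ne_zero h
  rw [toLaurent_monomial] at hne
  refine ⟨e, he, fun i => ?_⟩
  by_contra hi
  refine hne (Finsupp.single_eq_of_ne ?_)
  rintro rfl
  exact hi rfl

theorem toLaurent_prod_X_pow (A : Finset (Fin n)) (N : ℕ) :
    toLaurent k n (∏ i ∈ A, X i) ^ N =
      AddMonoidAlgebra.single (fun i => if i ∈ A then (N : ℤ) else 0) 1 := by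
  have h : (∏ i ∈ A, X i : MvPolynomial (Fin n) k) ^ N =
      monomial (∑ i ∈ A, Finsupp.single i N) 1 := by
    rw [← Finset.prod_pow, monomial_sum_one]
    exact Finset.prod_congr rfl fun i _ => X_pow_eq_monomial
  rw [← map_pow, h, toLaurent_monomial]
  congr 1
  funext i
  rw [Finsupp.finsetSum_apply]
  simp [Finsupp.single_apply, Finset.sum_ite_eq']

theorem mem_localized_monomialIdeal_iff (E : Set (Fin n →₀ ℕ)) (A : Finset (Fin n))
    (f : Laurent k n) : f ∈ localized (monomialIdeal k E) A ↔
      ∀ a, f.coeff a ≠ 0 → A ∈ degreeComplex E a := by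
  constructor
  · rintro ⟨N, g, hg, h⟩ a ha
    rw [toLaurent_prod_X_pow] at h
    have h1 : (toLaurent k n g).coeff ((fun i => if i ∈ A then (N : ℤ) else 0) + a) ≠ 0 := by
      rwa [h, AddMonoidAlgebra.coeff_single_mul_add, one_mul]
    obtain ⟨e', he', h2⟩ := exists_of_coeff_toLaurent_ne_zero h1
    obtain ⟨e, he, hle⟩ := mem_ideal_span_monomial_image.1 hg e' he'
    refine ⟨e, he, fun i hi => ?_⟩
    have h3 := h2 i
    simp only [Pi.add_apply, hi, if_false, zero_add] at h3
    rw [← h3]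
    exact_mod_cast hle i
  · intro h
    rw [← AddMonoidAlgebra.sum_coeff_single f]
    refine Submodule.sum_mem _ fun a ha => ?_
    obtain ⟨e, he, hle⟩ := h a (Finsupp.mem_support_iff.1 ha)
    -- This power of `x_A` makes up every deficit `eᵢ - aᵢ` with `i ∈ A` at once.
    set N : ℕ := ∑ i, ((e i : ℤ) - a i).toNat
    have hNi : ∀ i, (e i : ℤ) - a i ≤ N := fun i =>
      (Int.self_le_toNat _).trans (Int.ofNat_le.2
        (Finset.single_le_sum (f := fun i => ((e i : ℤ) - a i).toNat)
          (fun _ _ => Nat.zero_le _) (Finset.mem_univ i)))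
    have hb : ∀ i, (e i : ℤ) ≤ (if i ∈ A then (N : ℤ) else 0) + a i := by
      intro i
      by_cases hi : i ∈ A
      · rw [if_pos hi]
        have := hNi i
        omega
      · rw [if_neg hi, zero_add]
        exact hle i hi
    let b : Fin n →₀ ℕ :=
      Finsupp.equivFunOnFinite.symm fun i => ((if i ∈ A then (N : ℤ) else 0) + a i).toNat
    have hbi : ∀ i, (b i : ℤ) = (if i ∈ A then (N : ℤ) else 0) + a i := fun i =>
      Int.toNat_of_nonneg ((Int.natCast_nonneg _).trans (hb i))
    refine ⟨N, monomial b (f.coeff a), ?_, ?_⟩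
    · refine mem_ideal_span_monomial_image.2 fun x hx => ⟨e, he, ?_⟩
      obtain rfl := Finset.mem_singleton.1 (support_monomial_subset hx)
      exact fun i => Int.ofNat_le.1 ((hb i).trans_eq (hbi i).symm)
    · rw [toLaurent_monomial, toLaurent_prod_X_pow, AddMonoidAlgebra.single_mul_single, one_mul]
      congr 1
      funext i
      exact hbi i

theorem coeff_cechD (c : Finset (Fin n) → Laurent k n) (A : Finset (Fin n)) (a : Fin n → ℤ) :
    (cechD k n c A).coeff a = simplicialD (fun B => (c B).coeff a) A := by
  change (∑ i ∈ A, ((-1 : k) ^ (A.filter (· < i)).card) • c (A.erase i)).coeff a = _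
  rw [AddMonoidAlgebra.coeff_sum, Finsupp.finsetSum_apply]
  rfl

theorem mem_cochains_monomialIdeal_iff (E : Set (Fin n →₀ ℕ)) (p t : ℤ)
    (c : Finset (Fin n) → Laurent k n) : c ∈ cochains (monomialIdeal k E) p t ↔
      ∀ A a, (c A).coeff a ≠ 0 → A ∈ degreeComplex E a ∧ ∑ i, a i = t ∧ (A.card : ℤ) = p := by
  constructor
  · intro hc A a ha
    obtain ⟨⟨h1, h2⟩, h3⟩ := hc A
    refine ⟨(mem_localized_monomialIdeal_iff E A _).1 h1 a ha,
      h2 a (Finsupp.mem_support_iff.2 ha), ?_⟩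
    by_contra hne
    simp [h3 hne] at ha
  · refine fun h A => ⟨⟨(mem_localized_monomialIdeal_iff E A _).2 fun a ha => (h A a ha).1,
      fun a ha => (h A a (Finsupp.mem_support_iff.1 ha)).2.1⟩, fun hne => ?_⟩
    by_contra h0
    obtain ⟨a, ha⟩ : ∃ a, (c A).coeff a ≠ 0 := by
      by_contra! h'
      exact h0 (AddMonoidAlgebra.ext (Finsupp.ext h'))
    exact hne (h A a ha).2.2

theorem degreeComplex_mono {E : Set (Fin n →₀ ℕ)} {a : Fin n → ℤ} {A B : Finset (Fin n)}
    (hAB : A ⊆ B) (h : A ∈ degreeComplex E a) : B ∈ degreeComplex E a := by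
  obtain ⟨e, he, h⟩ := h
  exact ⟨e, he, fun i hi => h i fun hA => hi (hAB hA)⟩

/-- The differential preserves multidegrees, so primitives can be found one exponent at a time; only
finitely many exponents occur in a cocycle. -/
theorem cocycles_le_coboundaries (E : Set (Fin n →₀ ℕ)) (p t : ℤ)
    (h : ∀ a : Fin n → ℤ, ∑ i, a i = t → ExactAt k (degreeComplex E a) p) :
    cocycles (monomialIdeal k E) p t ≤ coboundaries (monomialIdeal k E) p t := by
  rintro c ⟨hc, hd⟩
  rw [SetLike.mem_coe, mem_cochains_monomialIdeal_iff] at hc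
  have hd' : cechD k n c = 0 := hd
  have key : ∀ a : Fin n → ℤ, ∃ ψ : Finset (Fin n) → k, ∑ i, a i = t →
      IsCochainOn (degreeComplex E a) (p - 1) ψ ∧
      ∀ A, simplicialD ψ A = (c A).coeff a := by
    intro a
    by_cases ha : ∑ i, a i = t
    · obtain ⟨ψ, h1, h2⟩ := h a ha (fun A => (c A).coeff a)
        (fun A hA => ⟨(hc A a hA).1, (hc A a hA).2.2⟩)
        (fun A _ => by rw [← coeff_cechD, hd']; rfl)
      refine ⟨ψ, fun _ => ⟨h1, fun A => ?_⟩⟩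
      by_cases hA : A ∈ degreeComplex E a
      · exact h2 A hA
      · rw [not_not.1 fun h' => hA (hc A a h').1]
        refine Finset.sum_eq_zero fun i _ => ?_
        rw [h1.eq_zero_of_notMem fun h' => hA (degreeComplex_mono (A.erase_subset i) h'),
          mul_zero]
    · exact ⟨0, fun h' => absurd h' ha⟩
  choose ψ hψ using key
  let U : Finset (Fin n → ℤ) := Finset.univ.biUnion fun A => (c A).coeff.support
  have hU : ∀ {a A}, a ∉ U → (c A).coeff a = 0 := by
    intro a A ha
    by_contra h'
    exact ha (Finset.mem_biUnion.2 ⟨A, Finset.mem_univ A, Finsupp.mem_support_iff.2 h'⟩)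
  have hUt : ∀ a ∈ U, ∑ i, a i = t := by
    intro a ha
    obtain ⟨A, -, hA⟩ := Finset.mem_biUnion.1 ha
    exact (hc A a (Finsupp.mem_support_iff.1 hA)).2.1
  let b : Finset (Fin n) → Laurent k n := fun A => ∑ a ∈ U, AddMonoidAlgebra.single a (ψ a A)
  have hb : ∀ A a, (b A).coeff a = if a ∈ U then ψ a A else 0 := by
    intro A a
    simp only [b]
    rw [AddMonoidAlgebra.coeff_sum, Finsupp.finsetSum_apply]
    simp [Finsupp.single_apply]
  refine ⟨b, (mem_cochains_monomialIdeal_iff E _ _ b).2 fun A a ha => ?_, ?_⟩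
  · rw [hb] at ha
    have haU : a ∈ U := by
      by_contra h'
      simp [h'] at ha
    rw [if_pos haU] at ha
    obtain ⟨h1, h2⟩ := (hψ a (hUt a haU)).1 A ha
    exact ⟨h1, hUt a haU, h2⟩
  · funext A
    refine AddMonoidAlgebra.ext (Finsupp.ext fun a => ?_)
    rw [coeff_cechD]
    by_cases haU : a ∈ U
    · rw [← (hψ a (hUt a haU)).2 A]
      exact simplicialD_congr fun i _ => by rw [hb, if_pos haU]
    · rw [hU haU]
      exact Finset.sum_eq_zero fun i _ => 
        mul_eq_zero_of_right _ ((hb _ a).trans (if_neg haU))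

theorem reg_monomialIdeal_le (E : Set (Fin n →₀ ℕ)) (r : EReal)
    (h : ∀ (a : Fin n → ℤ) (p : ℤ), r < (((∑ i, a i + p : ℤ) : ℝ) : EReal) →
      ExactAt k (degreeComplex E a) p) : reg (monomialIdeal k E) ≤ r := by
  refine sSup_le ?_
  rintro _ ⟨p, t, hnt, rfl⟩
  by_contra! hlt
  refine not_subsingleton (LocalCohomologyPart (monomialIdeal k E) p t) ?_
  rw [Submodule.Quotient.subsingleton_iff, Submodule.submoduleOf,
    Submodule.comap_subtype_eq_top]
  exact cocycles_le_coboundaries E p t fun a ha => h a p (by rwa [ha])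

/-- The socle degree `∑ (dᵢ - 1)` together with `-1` at the remaining variables carries a local
cohomology class of the ideal generated by the pure powers `xᵢ ^ dᵢ`, `i ∈ P`. -/
theorem le_reg_purePowers {P : Finset (Fin n)} (hP : P.Nonempty) (d : Fin n → ℕ)
    (hd : ∀ i ∈ P, 0 < d i) :
    (((∑ i ∈ P, ((d i : ℤ) - 1) + 1 : ℤ) : ℝ) : EReal) ≤
      reg (monomialIdeal k (purePowers P d)) := by
  set E := purePowers P d
  let a : Fin n → ℤ := fun i => if i ∈ P then (d i : ℤ) - 1 else -1
  have hsum : ∑ i, a i + (Pᶜ.card + 1 : ℕ) = ∑ i ∈ P, ((d i : ℤ) - 1) + 1 := by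
    rw [← Finset.sum_add_sum_compl P a,
      Finset.sum_congr rfl fun i hi => show a i = (d i : ℤ) - 1 from if_pos hi,
      Finset.sum_congr rfl fun i hi => show a i = -1 from if_neg (Finset.mem_compl.1 hi)]
    simp
  refine le_sSup ⟨Pᶜ.card + 1, ∑ i, a i, ?_, by rw [hsum]⟩
  -- The class is the coboundary of `x^a` placed at `Pᶜ`. The monomial is not in the localization
  -- there, but it is after inverting one more variable.
  let b : Finset (Fin n) → Laurent k n := fun A =>
    if A = Pᶜ then AddMonoidAlgebra.single a 1 else 0
  have hb : ∀ A x, (b A).coeff x ≠ 0 → A = Pᶜ ∧ x = a := by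
    intro A x hx
    by_cases hA : A = Pᶜ
    · refine ⟨hA, ?_⟩
      by_contra hxa
      simp only [b, hA, if_true] at hx
      exact hx (Finsupp.single_eq_of_ne hxa)
    · simp [b, hA] at hx
  have hcoc : cechD k n b ∈ cocycles (monomialIdeal k E) (Pᶜ.card + 1 : ℕ) (∑ i, a i) := by
    refine ⟨(mem_cochains_monomialIdeal_iff E _ _ _).2 fun A x hx => ?_, cechD_cechD b⟩
    rw [coeff_cechD] at hx
    obtain ⟨i, hi, hne⟩ := Finset.exists_ne_zero_of_sum_ne_zero hx
    obtain ⟨h1, rfl⟩ := hb _ _ (right_ne_zero_of_mul hne)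
    refine ⟨⟨Finsupp.single i (d i), ⟨i, ?_, rfl⟩, fun j hj => ?_⟩, rfl, ?_⟩
    · by_contra hiP
      exact Finset.notMem_erase i A (h1 ▸ Finset.mem_compl.2 hiP)
    · have hjP : j ∈ P := by
        by_contra hjP
        exact hj (Finset.mem_of_mem_erase (h1 ▸ Finset.mem_compl.2 hjP : j ∈ A.erase i))
      rw [Finsupp.single_eq_of_ne fun h : j = i => hj (h ▸ hi)]
      have := hd j hjP
      simp only [a, hjP, if_true]
      omega
    · rw [← h1, Finset.card_erase_add_one hi]
  rw [← not_subsingleton_iff_nontrivial, Submodule.Quotient.subsingleton_iff,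
    Submodule.submoduleOf, Submodule.comap_subtype_eq_top]
  intro hle
  obtain ⟨b', hb', he⟩ := hle hcoc
  rw [SetLike.mem_coe, mem_cochains_monomialIdeal_iff] at hb'
  obtain ⟨i, hi⟩ := hP
  have hiP : i ∉ Pᶜ := fun h => Finset.mem_compl.1 h hi
  -- Sets in the degree complex of `a` contain `Pᶜ` and meet `P`, so they have more than `|Pᶜ|`
  -- elements. Hence `b'` has no coefficient at `a`, while the coboundary of `b` has coefficient
  -- `±1` at `insert i Pᶜ`.
  have h0 : (cechD k n b' (insert i Pᶜ)).coeff a = 0 := by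
    rw [coeff_cechD]
    refine Finset.sum_eq_zero fun j _ => ?_
    by_contra hne
    obtain ⟨⟨_, ⟨l, hl, rfl⟩, hle⟩, -, hcard⟩ := hb' _ _ (right_ne_zero_of_mul hne)
    set B := (insert i Pᶜ).erase j
    have hlB : l ∈ B := by
      by_contra h
      have := hle l h
      simp only [Finsupp.single_eq_same, a, hl, if_true] at this
      omega
    have hPB : Pᶜ ⊆ B := by
      intro x hx
      by_contra h
      have := hle x h
      simp only [a, Finset.mem_compl.1 hx, if_false] at this
      omega
    have h2 := Finset.card_le_card (Finset.insert_subset hlB hPB)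
    rw [Finset.card_insert_of_notMem fun h => Finset.mem_compl.1 h hl] at h2
    push_cast at hcard
    omega
  rw [he, coeff_cechD, simplicialD, Finset.sum_eq_single i] at h0
  · rw [Finset.erase_insert hiP] at h0
    simp [b] at h0
  · intro j _ hji
    rw [mul_eq_zero]
    right
    by_contra hne
    have h1 := (hb _ _ hne).1
    have : i ∈ (insert i Pᶜ).erase j := Finset.mem_erase.2 ⟨hji.symm, Finset.mem_insert_self _ _⟩
    exact hiP (h1 ▸ this)
  · exact fun h => (h (Finset.mem_insert_self _ _)).elim

end MonomialIdeal

open scoped Pointwise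

/-! ### Pure power ideals and their products. -/

section PurePowers

variable {k : Type*} [Field k] {n : ℕ}

theorem IsPurePowerCI.exists_purePowers {I : Ideal (MvPolynomial (Fin n) k)}
    (hI : IsPurePowerCI I) : ∃ (P : Finset (Fin n)) (d : Fin n → ℕ),
      (∀ i ∈ P, 0 < d i) ∧ I = monomialIdeal k (purePowers P d) := by
  classical
  obtain ⟨G, hG, rfl, -⟩ := hI
  let Q : Fin n → ℕ → Prop := fun i m => 0 < m ∧ X i ^ m ∈ G
  -- The least exponent of each variable suffices, as higher powers are multiples. The value `0` is
  -- only taken outside `P`.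
  let d : Fin n → ℕ := fun i => if h : ∃ m, Q i m then Nat.find h else 0
  have hd : ∀ i, (∃ m, Q i m) → Q i (d i) := fun i h => by
    simp only [d, dif_pos h]
    exact Nat.find_spec h
  have hmon : ∀ (i : Fin n) (m : ℕ), monomial (Finsupp.single i m) (1 : k) = X i ^ m :=
    fun i m => X_pow_eq_monomial.symm
  refine ⟨Finset.univ.filter fun i => ∃ m, Q i m, d,
    fun i hi => (hd i (Finset.mem_filter.1 hi).2).1, le_antisymm ?_ ?_⟩
  · refine Ideal.span_le.2 fun u hu => ?_
    obtain ⟨i, m, hm, rfl⟩ := hG u hu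
    have hex : ∃ m, Q i m := ⟨m, hm, hu⟩
    have hle : d i ≤ m := by
      simp only [d, dif_pos hex]
      exact Nat.find_min' hex ⟨hm, hu⟩
    refine Ideal.mem_of_dvd _ (pow_dvd_pow (X i) hle) (Ideal.subset_span ?_)
    exact ⟨_, ⟨i, Finset.mem_filter.2 ⟨Finset.mem_univ i, hex⟩, rfl⟩, hmon i (d i)⟩
  · refine Ideal.span_le.2 ?_
    rintro _ ⟨_, ⟨i, hi, rfl⟩, rfl⟩
    refine Ideal.subset_span ?_
    simp only [hmon]
    exact (hd i (Finset.mem_filter.1 hi).2).2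

theorem monomialIdeal_mul (E E' : Set (Fin n →₀ ℕ)) :
    monomialIdeal k E * monomialIdeal k E' = monomialIdeal k (E + E') := by
  rw [monomialIdeal, monomialIdeal, Ideal.span_mul_span', monomialIdeal]
  congr 1
  ext u
  constructor
  · rintro ⟨_, ⟨e, he, rfl⟩, _, ⟨e', he', rfl⟩, rfl⟩
    exact ⟨e + e', Set.add_mem_add he he', by simp [monomial_mul]⟩
  · rintro ⟨_, ⟨e, he, e', he', rfl⟩, rfl⟩
    exact ⟨_, ⟨e, he, rfl⟩, _, ⟨e', he', rfl⟩, by simp [monomial_mul]⟩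

theorem mem_purePowers_add_add_iff (P : Fin 3 → Finset (Fin n)) (d : Fin 3 → Fin n → ℕ)
    (e : Fin n →₀ ℕ) :
    e ∈ purePowers (P 0) (d 0) + purePowers (P 1) (d 1) + purePowers (P 2) (d 2) ↔
      ∃ f : Fin 3 → Fin n, (∀ s, f s ∈ P s) ∧ e = ∑ s, Finsupp.single (f s) (d s (f s)) := by
  constructor
  · rintro ⟨_, ⟨_, ⟨i, hi, rfl⟩, _, ⟨j, hj, rfl⟩, rfl⟩, _, ⟨l, hl, rfl⟩, rfl⟩
    refine ⟨![i, j, l], fun s => ?_, ?_⟩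
    · fin_cases s <;> assumption
    · rw [Fin.sum_univ_three]
      rfl
  · rintro ⟨f, hf, rfl⟩
    rw [Fin.sum_univ_three]
    exact Set.add_mem_add (Set.add_mem_add ⟨_, hf 0, rfl⟩ ⟨_, hf 1, rfl⟩) ⟨_, hf 2, rfl⟩

/-- A choice of variables `f` corresponds to its fibres, the labels placed at each variable. -/
theorem degreeComplex_purePowers_add_add (P : Fin 3 → Finset (Fin n)) (d : Fin 3 → Fin n → ℕ)
    (a : Fin n → ℤ) :
    degreeComplex (purePowers (P 0) (d 0) + purePowers (P 1) (d 1) + purePowers (P 2) (d 2)) a =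
      {A | A ⊆ Finset.univ ∧ DegreeMem P d Finset.univ {Finset.univ} a A} := by
  ext A
  simp only [degreeComplex, Set.mem_ofPred_eq, mem_purePowers_add_add_iff, Finset.subset_univ,
    true_and]
  have hcoe : ∀ (f : Fin 3 → Fin n) i, (∑ s, Finsupp.single (f s) (d s (f s))) i =
      ∑ s with f s = i, d s i := by
    intro f i
    rw [Finsupp.finsetSum_apply, Finset.sum_filter]
    refine Finset.sum_congr rfl fun s _ => ?_
    by_cases h : f s = i
    · rw [h, Finsupp.single_eq_same, if_pos rfl]
    · rw [Finsupp.single_eq_of_ne (Ne.symm h), if_neg h]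
  constructor
  · rintro ⟨_, ⟨f, hf, rfl⟩, hle⟩
    refine ⟨fun i => Finset.univ.filter (f · = i), fun i _ s hs => ?_, ?_, fun i _ hi => ?_⟩
    · exact (Finset.mem_filter.1 hs).2 ▸ hf s
    · refine Finset.eq_univ_of_forall fun s => ?_
      simp
    · rw [← hcoe]
      exact hle i hi
  · rintro ⟨W, h1, h2, h3⟩
    have hex : ∀ s, ∃ i, s ∈ W i := by
      intro s
      have hs : s ∈ Finset.univ.biUnion W := by
        rw [Set.mem_singleton_iff.1 h2]
        exact Finset.mem_univ s
      obtain ⟨i, -, hi⟩ := Finset.mem_biUnion.1 hs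
      exact ⟨i, hi⟩
    -- The sets `W i` may overlap; keeping one place per label only lowers the exponents.
    choose f hf using hex
    refine ⟨_, ⟨f, fun s => h1 _ (Finset.mem_univ _) s (hf s), rfl⟩, fun i hi => ?_⟩
    refine le_trans ?_ (h3 i (Finset.mem_univ i) hi)
    rw [hcoe, Nat.cast_le]
    refine Finset.sum_le_sum_of_subset fun s hs => ?_
    obtain rfl := (Finset.mem_filter.1 hs).2
    exact hf s

theorem reg_purePowers_add_add_le (P : Fin 3 → Finset (Fin n)) (d : Fin 3 → Fin n → ℕ)
    (hd : ∀ s, ∀ i ∈ P s, 0 < d s i) :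
    reg (monomialIdeal k
      (purePowers (P 0) (d 0) + purePowers (P 1) (d 1) + purePowers (P 2) (d 2))) ≤
      (((∑ s, (∑ i ∈ P s, ((d s i : ℤ) - 1) + 1) : ℤ) : ℝ) : EReal) := by
  refine reg_monomialIdeal_le _ _ fun a p h => ?_
  rw [degreeComplex_purePowers_add_add]
  -- Here `c = 3` accounts for the `+ 1` of each of the three factors.
  refine exactAt_degreeMem k hd a Finset.univ {Finset.univ} 3 p ?_ ?_ ?_
  · rintro T T' hle rfl
    exact Finset.univ_subset_iff.1 hle
  · exact fun T hT => ⟨T, subset_rfl, hT, Finset.card_le_univ T⟩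
  · rw [EReal.coe_lt_coe_iff, Int.cast_lt, Finset.sum_add_distrib] at h
    refine lt_of_eq_of_lt ?_ h
    congr 1
    exact Finset.sum_comm' (by simp)

theorem reg_monomialIdeal_empty : reg (monomialIdeal k (∅ : Set (Fin n →₀ ℕ))) = ⊥ := by
  refine le_bot_iff.1 (reg_monomialIdeal_le _ _ fun a p _ => ?_)
  convert exactAt_empty p
  simp [degreeComplex]

end PurePowers

end CMRegularity

open CMRegularity in
theorem theorem3p2 {k : Type*} [Field k] {n : ℕ}
    (I J K : Ideal (MvPolynomial (Fin n) k))
    (hI : CMRegularity.IsPurePowerCI I) (hJ : CMRegularity.IsPurePowerCI J)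
    (hK : CMRegularity.IsPurePowerCI K) :
    CMRegularity.reg (I * J * K) ≤
      CMRegularity.reg I + CMRegularity.reg J + CMRegularity.reg K := by
  obtain ⟨P, d, hd, rfl⟩ := hI.exists_purePowers
  obtain ⟨P', d', hd', rfl⟩ := hJ.exists_purePowers
  obtain ⟨P'', d'', hd'', rfl⟩ := hK.exists_purePowers
  rw [monomialIdeal_mul, monomialIdeal_mul]
  have hempty : ∀ d : Fin n → ℕ, purePowers ∅ d = ∅ := fun d => by simp [purePowers]
  rcases P.eq_empty_or_nonempty with rfl | hP
  · rw [hempty, Set.empty_add, Set.empty_add, reg_monomialIdeal_empty]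
    exact bot_le
  rcases P'.eq_empty_or_nonempty with rfl | hP'
  · rw [hempty, Set.add_empty, Set.empty_add, reg_monomialIdeal_empty]
    exact bot_le
  rcases P''.eq_empty_or_nonempty with rfl | hP''
  · rw [hempty, Set.add_empty, reg_monomialIdeal_empty]
    exact bot_le
  refine (reg_purePowers_add_add_le ![P, P', P''] ![d, d', d''] fun s => ?_).trans ?_
  · fin_cases s <;> assumption
  · rw [Fin.sum_univ_three, Int.cast_add, Int.cast_add, EReal.coe_add, EReal.coe_add]
    exact add_le_add (add_le_add (le_reg_purePowers hP d hd) (le_reg_purePowers hP' d' hd'))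
      (le_reg_purePowers hP'' d'' hd'')
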